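/- Let $d,\kappa\ge 1$, let $G$ be an $\mathbb R^\kappa$-valued centered stationary Gaussian random field on $\mathbb R^d$ (jointly measurable, on a probability space), with covariance function $c(x)=\mathbb E[G(x)\otimes G(0)]$. Let $\lambda>0$ and let $a_0\in C^1_b(\mathbb R^\kappa;\mathbb R^{d\times d})$ take values in the symmetric matrices $b$ with $|b\xi|\le|\xi|$ and $\xi\cdot b\xi\ge\lambda|\xi|^2$ for all $\xi\in\mathbb R^d$. Set $a(x)=a_0(G(x))$. For $1\le i\le d$ let $\phi_i$ be a corrector in the direction $e_i$: a random field whose weak gradient $\nabla\phi_i$ is stationary, namely a shift-covariant measurable functional of $a$, i.e. $\nabla\phi_i(\cdot+z;a)=\nabla\phi_i(\cdot;a(\cdot+z))$, has finite second moments and vanishing expectation, and such that almost surely $-\nabla\cdot a(\nabla\phi_i+e_i)=0$ in the distributional sense on $\mathbb R^d$. Define $$\mathcal K^l_{ij}:=\mathbb E\big[(\nabla\phi_j+e_j)\cdot\partial_l a_0(G)(\nabla\phi_i+e_i)\big],\qquad 1\le i,j\le d,\ 1\le l\le\kappa$$ (by stationarity the expectation is evaluated at the origin). Let $1\le l\le\kappa$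 be such that for every $y\in\mathbb R^\kappa$ the symmetric matrix $\partial_l a_0(y)$ is definite (positive definite or negative definite). Then $\mathcal K^l_{ii}\ne0$ for all $1\le i\le d$. Consequently, in the non-integrable case $0<\beta<d$, the fluctuation tensor field is non-degenerate in the following sense: if $L^\beta c_{l'm'}(L\,\cdot)$ converges weakly-* in $L^\infty(\mathbb S^{d-1})$ to $C_{l'm'}$ as $L\uparrow\infty$ for all $l',m'$ with $\mathcal K^{l'}\ne0\ne\mathcal K^{m'}$, then at every $u\in\mathbb S^{d-1}$ at which the matrix $C(u)$ is positive definite (that is, $v\cdot C(u)v>0$ for all $v\neq0$), the tensor $$\mathcal Q_{iji'j'}(u):=\sum_{l',m'=1}^{\kappa}\mathcal K^{l'}_{ij}\,\mathcal K^{m'}_{i'j'}\,C_{l'm'}(u)$$ satisfies $\mathcal Q_{iiii}(u)\ne0$ for all $1\le i\le d$. -/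

import Mathlib

open MeasureTheory ProbabilityTheory Filter Topology

/-- Stationarity of a random field `Z` on `ℝ^d`: its finite-dimensional distributions are
invariant under translations. -/
def IsStationaryField {d : ℕ} {Ω S : Type*} [MeasurableSpace Ω] [MeasurableSpace S]
    (P : Measure Ω) (Z : EuclideanSpace ℝ (Fin d) → Ω → S) : Prop :=
  ∀ (n : ℕ) (x : Fin n → EuclideanSpace ℝ (Fin d)) (z : EuclideanSpace ℝ (Fin d)),
    IdentDistrib (fun ω j => Z (x j + z) ω) (fun ω j => Z (x j) ω) P P

/-- `G` is a (jointly measurable) centered stationary Gaussian random field on `ℝ^d` with values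
in `ℝ^κ`. -/
structure IsStationaryGaussianField {d κ : ℕ} {Ω : Type*} [MeasurableSpace Ω] (P : Measure Ω)
    (G : EuclideanSpace ℝ (Fin d) → Ω → EuclideanSpace ℝ (Fin κ)) : Prop where
  measurable : Measurable (Function.uncurry G)
  gaussian : IsGaussianProcess G P
  centered : ∀ x, ∫ ω, G x ω ∂P = 0
  stationary : IsStationaryField P G

/-- The covariance function `c(x) = E[G(x) ⊗ G(0)]`. -/
noncomputable def covFun {d κ : ℕ} {Ω : Type*} [MeasurableSpace Ω] (P : Measure Ω)
    (G : EuclideanSpace ℝ (Fin d) → Ω → EuclideanSpace ℝ (Fin κ))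
    (x : EuclideanSpace ℝ (Fin d)) : Matrix (Fin κ) (Fin κ) ℝ :=
  Matrix.of fun l m => ∫ ω, G x ω l * G 0 ω m ∂P

/-- The set of symmetric matrices `b` with `|b ξ| ≤ |ξ|` and `ξ · b ξ ≥ lam |ξ|²` for all `ξ`. -/
def ellipticSym (d : ℕ) (lam : ℝ) : Set (Matrix (Fin d) (Fin d) ℝ) :=
  {b | b.IsSymm ∧ ∀ ξ : EuclideanSpace ℝ (Fin d),
    ‖Matrix.toEuclideanCLM (𝕜 := ℝ) b ξ‖ ≤ ‖ξ‖ ∧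
    lam * ‖ξ‖ ^ 2 ≤ inner ℝ ξ (Matrix.toEuclideanCLM (𝕜 := ℝ) b ξ)}

/-- The partial derivative `∂_l a₀(y)` of a matrix-valued map, taken entrywise. -/
noncomputable def partialMat {d κ : ℕ}
    (a₀ : EuclideanSpace ℝ (Fin κ) → Matrix (Fin d) (Fin d) ℝ) (l : Fin κ)
    (y : EuclideanSpace ℝ (Fin κ)) : Matrix (Fin d) (Fin d) ℝ :=
  Matrix.of fun i j => fderiv ℝ (fun y' => a₀ y' i j) y (EuclideanSpace.single l 1)

/-- `a₀ ∈ C¹_b(ℝ^κ; M_sym)`: continuously differentiable with bounded first derivatives and with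
values in the symmetric matrices of ellipticity `lam` (hence bounded). -/
structure IsC1bElliptic {d κ : ℕ} (lam : ℝ)
    (a₀ : EuclideanSpace ℝ (Fin κ) → Matrix (Fin d) (Fin d) ℝ) : Prop where
  mem : ∀ y, a₀ y ∈ ellipticSym d lam
  contDiff : ∀ i j, ContDiff ℝ 1 (fun y => a₀ y i j)
  bounded : ∃ M : ℝ, ∀ l y i j, |partialMat a₀ l y i j| ≤ M

/-- `p` is the weak (distributional) gradient of `u` on `ℝ^d`. -/
structure IsWeakGradient {d : ℕ} (u : EuclideanSpace ℝ (Fin d) → ℝ)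
    (p : EuclideanSpace ℝ (Fin d) → EuclideanSpace ℝ (Fin d)) : Prop where
  locInt : LocallyIntegrable u volume
  locInt_grad : LocallyIntegrable p volume
  integral_eq : ∀ η : EuclideanSpace ℝ (Fin d) → ℝ, ContDiff ℝ (⊤ : ℕ∞) η → HasCompactSupport η →
    ∫ x, u x • gradient η x = - ∫ x, η x • p x

/-- The sigma-algebra generated by the random matrix field `a`. -/
@[reducible] def sigmaField {d : ℕ} {Ω : Type*}
    (a : EuclideanSpace ℝ (Fin d) → Ω → Matrix (Fin d) (Fin d) ℝ) : MeasurableSpace Ω :=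
  ⨆ (x : EuclideanSpace ℝ (Fin d)) (j : Fin d) (k : Fin d),
    MeasurableSpace.comap (fun ω => a x ω j k) inferInstance

/-- `φ i` is the corrector in the direction `e_i` of the random coefficient field `a`, and `p i`
is its gradient `∇φ_i`. The gradient is a shift-covariant functional of `a`, that is
`∇φ_i(· + z; a) = ∇φ_i(·; a(· + z))`: this is expressed by measurability of `∇φ_i(x)` with respect
to `a` (up to null sets) together with joint stationarity of `(a, ∇φ)`. The gradient has finite
second moments and vanishing expectation, and almost surely `-∇ · a (∇φ_i + e_i) = 0` holds in the
distributional sense on `ℝ^d`. -/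
structure IsCorrector {d : ℕ} {Ω : Type*} [MeasurableSpace Ω] (P : Measure Ω)
    (a : EuclideanSpace ℝ (Fin d) → Ω → Matrix (Fin d) (Fin d) ℝ)
    (φ : Fin d → EuclideanSpace ℝ (Fin d) → Ω → ℝ)
    (p : Fin d → EuclideanSpace ℝ (Fin d) → Ω → EuclideanSpace ℝ (Fin d)) : Prop where
  measurable : ∀ i, Measurable (Function.uncurry (φ i))
  measurable_grad : ∀ i, Measurable (Function.uncurry (p i))
  isWeakGradient : ∀ i, ∀ᵐ ω ∂P, IsWeakGradient (fun x => φ i x ω) (fun x => p i x ω)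
  functional : ∀ i x, AEStronglyMeasurable[sigmaField a] (p i x) P
  stationary : IsStationaryField P
    (fun x ω => ((fun j k => a x ω j k, fun i => p i x ω) :
      (Fin d → Fin d → ℝ) × (Fin d → EuclideanSpace ℝ (Fin d))))
  memLp : ∀ i x, MemLp (p i x) 2 P
  mean_zero : ∀ i x, ∫ ω, p i x ω ∂P = 0
  equation : ∀ i, ∀ᵐ ω ∂P, ∀ η : EuclideanSpace ℝ (Fin d) → ℝ,
    ContDiff ℝ (⊤ : ℕ∞) η → HasCompactSupport η →
      ∫ x, inner ℝ (gradient η x) (Matrix.toEuclideanCLM (𝕜 := ℝ) (a x ω)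
        (p i x ω + EuclideanSpace.single i 1)) = 0

/-- `K^l_{ij} = E[(∇φ*_j + e_j) · ∂_l a₀(G) (∇φ_i + e_i)]`, where `p i = ∇φ_i` and
`pstar j = ∇φ*_j` (the corrector gradient of the transposed field, so that `pstar = p` if `a` is
symmetric). By stationarity the expectation is taken at the origin. -/
noncomputable def tensorK {d κ : ℕ} {Ω : Type*} [MeasurableSpace Ω] (P : Measure Ω)
    (a₀ : EuclideanSpace ℝ (Fin κ) → Matrix (Fin d) (Fin d) ℝ)
    (G : EuclideanSpace ℝ (Fin d) → Ω → EuclideanSpace ℝ (Fin κ))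
    (p pstar : Fin d → EuclideanSpace ℝ (Fin d) → Ω → EuclideanSpace ℝ (Fin d))
    (l : Fin κ) (i j : Fin d) : ℝ :=
  ∫ ω, inner ℝ (pstar j 0 ω + EuclideanSpace.single j 1)
    (Matrix.toEuclideanCLM (𝕜 := ℝ) (partialMat a₀ l (G 0 ω))
      (p i 0 ω + EuclideanSpace.single i 1)) ∂P

/-- The functions `u ↦ L^β f(L u)` converge to `C` weakly-* in `L^∞(S^{d-1})` as `L → ∞`. -/
def WeakStarScalingLimit {d : ℕ} (β : ℝ) (f : EuclideanSpace ℝ (Fin d) → ℝ)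
    (C : Metric.sphere (0 : EuclideanSpace ℝ (Fin d)) 1 → ℝ) : Prop :=
  MemLp C ⊤ (volume : Measure (EuclideanSpace ℝ (Fin d))).toSphere ∧
  ∀ h : Metric.sphere (0 : EuclideanSpace ℝ (Fin d)) 1 → ℝ,
    Integrable h (volume : Measure (EuclideanSpace ℝ (Fin d))).toSphere →
    Tendsto (fun L : ℝ => ∫ u, h u * (L ^ β * f (L • (u : EuclideanSpace ℝ (Fin d))))
        ∂(volume : Measure (EuclideanSpace ℝ (Fin d))).toSphere) atTop
      (𝓝 (∫ u, h u * C u ∂(volume : Measure (EuclideanSpace ℝ (Fin d))).toSphere))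

/-- The fluctuation tensor `Q_{iji'j'}(u) = ∑_{l,m} K^l_{ij} K^m_{i'j'} C_{lm}(u)`, as a function
of the tensor `K` and of the matrix `C = C(u)`. -/
def fluctTensor {d κ : ℕ} (K : Fin κ → Fin d → Fin d → ℝ) (C : Matrix (Fin κ) (Fin κ) ℝ)
    (i j i' j' : Fin d) : ℝ :=
  ∑ l, ∑ m, K l i j * K m i' j' * C l m

/-! Since `ℝ^κ` is connected and `∂_l a₀` is continuous and everywhere definite, its sign is
constant (`forall_posDef_or_forall_neg_posDef`). So `K^l_ii` is, up to a global sign, the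
expectation of a nonnegative quadratic form in `V = ∇φ_i(0) + e_i`. If it vanished, definiteness
would force `V = 0` almost surely (`ae_eq_zero_of_integral_inner_posDef_eq_zero`), contradicting
`E[V] = e_i`. The tensor `Q_iiii(u)` is the quadratic form of `C(u)` at the vector `(K^m_ii)_m`,
which is nonzero because of its `l`-th entry. -/

theorem inner_toEuclideanCLM_eq_sum {d : ℕ} (B : Matrix (Fin d) (Fin d) ℝ)
    (v w : EuclideanSpace ℝ (Fin d)) :
    inner ℝ v (Matrix.toEuclideanCLM (𝕜 := ℝ) B w) = ∑ j, ∑ k, B j k * (v j * w k) := by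
  simp only [PiLp.inner_apply, Matrix.ofLp_toEuclideanCLM, Matrix.mulVec, dotProduct,
    RCLike.inner_apply, conj_trivial, Finset.sum_mul]
  refine Finset.sum_congr rfl fun j _ => Finset.sum_congr rfl fun k _ => ?_
  ring

theorem inner_toEuclideanCLM_pos {d : ℕ} {B : Matrix (Fin d) (Fin d) ℝ} (hB : B.PosDef)
    {v : EuclideanSpace ℝ (Fin d)} (hv : v ≠ 0) :
    0 < inner ℝ v (Matrix.toEuclideanCLM (𝕜 := ℝ) B v) := by
  have h := hB.dotProduct_mulVec_pos (x := v.ofLp) (by simpa using hv)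
  rw [inner_toEuclideanCLM_eq_sum]
  simpa only [dotProduct, Matrix.mulVec, Finset.mul_sum, star_trivial, mul_left_comm] using h

/-- The expectation of a positive definite, bounded random quadratic form evaluated at a square
integrable random vector vanishes only if the vector vanishes almost surely. -/
theorem ae_eq_zero_of_integral_inner_posDef_eq_zero {d : ℕ} {Ω : Type*} [MeasurableSpace Ω]
    {P : Measure Ω} {V : Ω → EuclideanSpace ℝ (Fin d)} (hV : MemLp V 2 P)
    {B : Ω → Matrix (Fin d) (Fin d) ℝ} (hBm : ∀ j k, AEStronglyMeasurable (fun ω => B ω j k) P)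
    {M : ℝ} (hBM : ∀ ω j k, |B ω j k| ≤ M) (hB : ∀ ω, (B ω).PosDef)
    (h : ∫ ω, inner ℝ (V ω) (Matrix.toEuclideanCLM (𝕜 := ℝ) (B ω) (V ω)) ∂P = 0) :
    V =ᵐ[P] 0 := by
  have hcomp (j : Fin d) : MemLp (fun ω => V ω j) 2 P :=
    (EuclideanSpace.proj (𝕜 := ℝ) j).comp_memLp' hV
  -- Integrability is essential: the Bochner integral of a non-integrable function is 0 by
  -- convention, so `h` alone would say nothing. Products of L² components are integrable, and the
  -- entries of `B` are bounded.
  have hint : Integrable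
      (fun ω => inner ℝ (V ω) (Matrix.toEuclideanCLM (𝕜 := ℝ) (B ω) (V ω))) P := by
    simp only [inner_toEuclideanCLM_eq_sum]
    refine integrable_finsetSum _ fun j _ => integrable_finsetSum _ fun k _ => ?_
    exact ((hcomp j).integrable_mul (hcomp k)).bdd_mul (hBm j k)
      (Eventually.of_forall fun ω => hBM ω j k)
  have hnonneg (ω : Ω) : 0 ≤ inner ℝ (V ω) (Matrix.toEuclideanCLM (𝕜 := ℝ) (B ω) (V ω)) := by
    by_cases hω : V ω = 0
    · simp [hω]
    · exact (inner_toEuclideanCLM_pos (hB ω) hω).le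
  filter_upwards [(integral_eq_zero_iff_of_nonneg hnonneg hint).1 h] with ω hω
  by_contra hne
  exact (inner_toEuclideanCLM_pos (hB ω) hne).ne' hω

/-- A continuous family of definite matrices over a preconnected space has constant sign. -/
theorem forall_posDef_or_forall_neg_posDef {X : Type*} [TopologicalSpace X] [PreconnectedSpace X]
    {d : ℕ} (i : Fin d) {B : X → Matrix (Fin d) (Fin d) ℝ} (hc : Continuous fun x => B x i i)
    (hB : ∀ x, (B x).PosDef ∨ (-B x).PosDef) :
    (∀ x, (B x).PosDef) ∨ ∀ x, (-B x).PosDef := by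
  -- A single diagonal entry detects the sign of a definite matrix and never vanishes, which reduces
  -- the claim to the intermediate value theorem for a scalar function.
  have hneg {x : X} (hx : (-B x).PosDef) : B x i i < 0 := by simpa using hx.diag_pos (i := i)
  by_contra! hcon
  obtain ⟨⟨x, hx⟩, y, hy⟩ := hcon
  have hx' : B x i i < 0 := hneg ((hB x).resolve_left hx)
  have hy' : 0 < B y i i := ((hB y).resolve_right hy).diag_pos
  obtain ⟨z, hz⟩ := mem_range_of_exists_le_of_exists_ge hc ⟨x, hx'.le⟩ ⟨y, hy'.le⟩
  rcases hB z with h | h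
  · exact h.diag_pos.ne' hz
  · exact (hneg h).ne hz

theorem IsC1bElliptic.continuous_partialMat {d κ : ℕ} {lam : ℝ}
    {a₀ : EuclideanSpace ℝ (Fin κ) → Matrix (Fin d) (Fin d) ℝ} (ha₀ : IsC1bElliptic lam a₀)
    (l : Fin κ) (i j : Fin d) : Continuous fun y => partialMat a₀ l y i j :=
  ((ha₀.contDiff i j).continuous_fderiv one_ne_zero).clm_apply continuous_const

/-- A corrector gradient of mean zero cannot cancel the constant `e_i` almost surely, whereas a
vanishing expectation of a form of constant sign would require exactly that. -/
theorem tensorK_diag_ne_zero {d κ : ℕ} {Ω : Type*} [MeasurableSpace Ω] {P : Measure Ω}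
    [IsProbabilityMeasure P]
    {G : EuclideanSpace ℝ (Fin d) → Ω → EuclideanSpace ℝ (Fin κ)} (hG : Measurable (G 0))
    {lam : ℝ} {a₀ : EuclideanSpace ℝ (Fin κ) → Matrix (Fin d) (Fin d) ℝ}
    (ha₀ : IsC1bElliptic lam a₀)
    {p : Fin d → EuclideanSpace ℝ (Fin d) → Ω → EuclideanSpace ℝ (Fin d)} {i : Fin d}
    (hp : MemLp (p i 0) 2 P) (hmean : ∫ ω, p i 0 ω ∂P = 0) {l : Fin κ}
    (hdef : ∀ y, (partialMat a₀ l y).PosDef ∨ (-partialMat a₀ l y).PosDef) :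
    tensorK P a₀ G p p l i i ≠ 0 := by
  intro hK
  obtain ⟨M, hM⟩ := ha₀.bounded
  have hV : MemLp (fun ω => p i 0 ω + EuclideanSpace.single i (1 : ℝ)) 2 P :=
    hp.add (memLp_const _)
  have hmeas (j k : Fin d) : Measurable fun ω => partialMat a₀ l (G 0 ω) j k :=
    (ha₀.continuous_partialMat l j k).measurable.comp hG
  have hzero : (fun ω => p i 0 ω + EuclideanSpace.single i (1 : ℝ)) =ᵐ[P] 0 := by
    rcases forall_posDef_or_forall_neg_posDef i (ha₀.continuous_partialMat l i i) hdef with h | h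
    · exact ae_eq_zero_of_integral_inner_posDef_eq_zero hV
        (fun j k => (hmeas j k).aestronglyMeasurable) (fun ω => hM l (G 0 ω))
        (fun ω => h (G 0 ω)) hK
    · refine ae_eq_zero_of_integral_inner_posDef_eq_zero hV
        (B := fun ω => -partialMat a₀ l (G 0 ω))
        (fun j k => (hmeas j k).neg.aestronglyMeasurable) (M := M)
        (fun ω j k => by simpa using hM l (G 0 ω) j k) (fun ω => h (G 0 ω)) ?_
      simpa only [map_neg, neg_apply, inner_neg_right, integral_neg,
        neg_eq_zero, tensorK] using hK
  -- Taking expectations in `∇φ_i(0) + e_i = 0` leaves `e_i = 0`, which fails in the `i`-th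
  -- coordinate.
  have hsum := integral_add (hp.integrable one_le_two)
    (integrable_const (μ := P) (EuclideanSpace.single i (1 : ℝ)))
  rw [integral_congr_ae hzero, hmean] at hsum
  simp only [Pi.zero_apply, integral_const, probReal_univ, one_smul,
    zero_add] at hsum
  simpa using congrArg (fun v : EuclideanSpace ℝ (Fin d) => v i) hsum

theorem fluctTensor_diag {d κ : ℕ} (K : Fin κ → Fin d → Fin d → ℝ)
    (C : Matrix (Fin κ) (Fin κ) ℝ) (i : Fin d) :
    fluctTensor K C i i i i = (fun l => K l i i) ⬝ᵥ C.mulVec (fun l => K l i i) := by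
  simp only [fluctTensor, dotProduct, Matrix.mulVec, Finset.mul_sum]
  refine Finset.sum_congr rfl fun l _ => Finset.sum_congr rfl fun m _ => ?_
  ring

theorem mainTheorem5 {d κ : ℕ} {Ω : Type*} [MeasurableSpace Ω] (P : Measure Ω)
    [IsProbabilityMeasure P]
    (G : EuclideanSpace ℝ (Fin d) → Ω → EuclideanSpace ℝ (Fin κ))
    (hG : IsStationaryGaussianField P G)
    (lam : ℝ) (hlam : 0 < lam)
    (a₀ : EuclideanSpace ℝ (Fin κ) → Matrix (Fin d) (Fin d) ℝ) (ha₀ : IsC1bElliptic lam a₀)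
    (φ : Fin d → EuclideanSpace ℝ (Fin d) → Ω → ℝ)
    (p : Fin d → EuclideanSpace ℝ (Fin d) → Ω → EuclideanSpace ℝ (Fin d))
    (hφ : IsCorrector P (fun x ω => a₀ (G x ω)) φ p)
    (l : Fin κ)
    (hdef : ∀ y, (partialMat a₀ l y).PosDef ∨ (-partialMat a₀ l y).PosDef) :
    (∀ i, tensorK P a₀ G p p l i i ≠ 0) ∧
    (∀ (β : ℝ), 0 < β → β < d →
      ∀ C : Metric.sphere (0 : EuclideanSpace ℝ (Fin d)) 1 → Matrix (Fin κ) (Fin κ) ℝ,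
        (∀ l' m', tensorK P a₀ G p p l' ≠ 0 → tensorK P a₀ G p p m' ≠ 0 →
          WeakStarScalingLimit β (fun x => covFun P G x l' m') (fun u => C u l' m')) →
        ∀ u, (∀ v : Fin κ → ℝ, v ≠ 0 → 0 < v ⬝ᵥ (C u).mulVec v) →
          ∀ i, fluctTensor (tensorK P a₀ G p p) (C u) i i i i ≠ 0) := by
  have hK (i : Fin d) : tensorK P a₀ G p p l i i ≠ 0 :=
    tensorK_diag_ne_zero (hG.measurable.comp measurable_prodMk_left) ha₀ (hφ.memLp i 0)
      (hφ.mean_zero i 0) hdef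
  refine ⟨hK, fun β _ _ C _ u hu i => ?_⟩
  rw [fluctTensor_diag]
  -- If the vector of diagonal entries were zero, its `l`-th component would contradict `hK i`.
  exact (hu _ fun h => hK i (congrFun h l)).ne'
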